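/- Let $M$ be a compact topological space with a finite Radon (regular Borel) measure $\mu$, and let $\mathcal E$ be a Dirichlet form on $L^2(M,\mu)$ with domain $\mathcal D(\mathcal E)$: a nonnegative, symmetric bilinear form on a dense subspace $\mathcal D(\mathcal E)\subset L^2(M,\mu)$, closed (that is, $\mathcal D(\mathcal E)$ is complete for the norm $(\mathcal E(v)+\|v\|_{L^2}^2)^{1/2}$, where $\mathcal E(v)=\mathcal E(v,v)$), such that $v\in\mathcal D(\mathcal E)$ implies $|v|\in\mathcal D(\mathcal E)$ with $\mathcal E(|v|)\le\mathcal E(v)$, and $0\le v\in\mathcal D(\mathcal E)$ implies $\inf\{v,1\}\in\mathcal D(\mathcal E)$ with $\mathcal E(\inf\{v,1\})\le\mathcal E(v)$. Let $L$ be its generator. Assume that $\mathcal E$ is - regular: $\mathcal D(\mathcal E)\cap C^0(M)$ is dense in $\mathcal D(\mathcal E)$ for the norm $(\mathcal E(v)+\|v\|_{L^2}^2)^{1/2}$ and dense in $C^0(M)$ for the uniform norm; - strongly local: $\mathcal E(u,v)=0$ whenever $u,v\in\mathcal D(\mathcal E)$ and $u$ is constant in a neighbourhood of $\operatorname{supp}(v)$;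 and that there are $\nu>2$ and $A,B>0$ such that the Sobolev inequality $$\|v\|_{L^{2\nu/(\nu-2)}}^2\le A\,\mathcal E(v)+B\,\|v\|_{L^2}^2\qquad\text{for all } v\in\mathcal D(\mathcal E)$$ holds. Let $V\in L^1(M,\mu)$ be real-valued and suppose that $V_-=\max\{0,-V\}$ is infinitesimally form bounded with respect to $\mathcal E$: for every $\varepsilon>0$ there is $c(\varepsilon)$ with $$\int_M V_-v^2\,d\mu\le\varepsilon\,\mathcal E(v)+c(\varepsilon)\int_M v^2\,d\mu\qquad\text{for all } v\in\mathcal D(\mathcal E).$$ Put $\mathcal D(\mathcal E_V)=\{v\in\mathcal D(\mathcal E):\int_M Vv^2\,d\mu<\infty\}$, $\mathcal E_V(u,v)=\mathcal E(u,v)+\int_M Vuv\,d\mu$ for $u,v\in\mathcal D(\mathcal E_V)$, and $$Y(V)=\inf\{\mathcal E_V(v,v): v\in\mathcal D(\mathcal E_V),\ \|v\|_{L^{2\nu/(\nu-2)}}=1\}.$$ If $u\in\mathcal D(\mathcal E_V)$ is a nonnegative solution of $$Lu+Vu=Y(V)\,u^{\frac{\nu+2}{\nu-2}}$$ in the weak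 sense, i.e. $\mathcal E_V(u,\varphi)=Y(V)\int_M u^{\frac{\nu+2}{\nu-2}}\varphi\,d\mu$ for every $\varphi\in\mathcal D(\mathcal E_V)$, then $$\int_M u^p\,d\mu<\infty\qquad\text{for every } p\ge 2.$$ -/

import Mathlib

open MeasureTheory Filter Topology

namespace DirichletYamabe

/-- A nonnegative closed symmetric bilinear form on a dense subspace of `L²(M, μ)`. -/
structure ClosedSymmetricForm {M : Type*} [MeasurableSpace M] (μ : Measure M) where
  /-- The domain `𝒟(ℰ)`. -/
  domain : Submodule ℝ (Lp ℝ 2 μ)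
  /-- The bilinear form `ℰ : 𝒟(ℰ) × 𝒟(ℰ) → ℝ`. -/
  form : LinearMap.BilinForm ℝ domain
  dense_domain : Dense (domain : Set (Lp ℝ 2 μ))
  symm : ∀ u v : domain, form u v = form v u
  nonneg : ∀ v : domain, 0 ≤ form v v
  /-- Closedness: `𝒟(ℰ)` is complete for the norm `(ℰ(v) + ‖v‖²)^{1/2}`. -/
  closed : ∀ s : ℕ → domain,
    (∀ ε : ℝ, 0 < ε → ∃ N : ℕ, ∀ m n : ℕ, N ≤ m → N ≤ n →
      form (s m - s n) (s m - s n) + ‖s m - s n‖ ^ 2 < ε) →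
    ∃ u : domain,
      Tendsto (fun n => form (s n - u) (s n - u) + ‖s n - u‖ ^ 2) atTop (𝓝 0)

/-- A Dirichlet form on `L²(M, μ)`, `μ` finite: a closed symmetric form that has the two
Beurling-Deny contraction properties. -/
structure DirichletForm {M : Type*} [MeasurableSpace M] (μ : Measure M) [IsFiniteMeasure μ]
    extends ClosedSymmetricForm μ where
  /-- `|v| ∈ 𝒟(ℰ)` and `ℰ(|v|) ≤ ℰ(v)` for `v ∈ 𝒟(ℰ)`. -/
  abs_contraction : ∀ v : domain, ∃ h : |(v : Lp ℝ 2 μ)| ∈ domain,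
    form ⟨|(v : Lp ℝ 2 μ)|, h⟩ ⟨|(v : Lp ℝ 2 μ)|, h⟩ ≤ form v v
  /-- `inf {v, 1} ∈ 𝒟(ℰ)` and `ℰ(inf {v, 1}) ≤ ℰ(v)` for `0 ≤ v ∈ 𝒟(ℰ)`. -/
  inf_one_contraction : ∀ v : domain, 0 ≤ (v : Lp ℝ 2 μ) →
    ∃ h : (v : Lp ℝ 2 μ) ⊓ Lp.const 2 μ (1 : ℝ) ∈ domain,
      form ⟨(v : Lp ℝ 2 μ) ⊓ Lp.const 2 μ (1 : ℝ), h⟩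
        ⟨(v : Lp ℝ 2 μ) ⊓ Lp.const 2 μ (1 : ℝ), h⟩ ≤ form v v

/-- The support of (the class of) a function `v`: the complement of the union of all open sets on
which `v` vanishes almost everywhere. -/
def essSupport {M : Type*} [MeasurableSpace M] [TopologicalSpace M] (μ : Measure M)
    (v : M → ℝ) : Set M :=
  {x | ∀ U : Set M, IsOpen U → x ∈ U → ¬ (∀ᵐ y ∂μ, y ∈ U → v y = 0)}

namespace DirichletForm

/-- Regularity: `𝒟(ℰ) ∩ C⁰(M)` is dense in `𝒟(ℰ)` for the norm `(ℰ(v) + ‖v‖²)^{1/2}`, and dense in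
`C⁰(M)` for the uniform norm. -/
structure IsRegular {M : Type*} [TopologicalSpace M] [CompactSpace M] [MeasurableSpace M]
    [BorelSpace M] {μ : Measure M} [IsFiniteMeasure μ] (E : DirichletForm μ) : Prop where
  dense_in_domain : ∀ v : E.domain, ∀ ε : ℝ, 0 < ε →
    ∃ w : E.domain, (∃ f : C(M, ℝ), (w : Lp ℝ 2 μ) = ContinuousMap.toLp 2 μ ℝ f) ∧
      E.form (v - w) (v - w) + ‖v - w‖ ^ 2 < ε
  dense_in_continuous : Dense {f : C(M, ℝ) | ContinuousMap.toLp 2 μ ℝ f ∈ E.domain}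

/-- Strong locality: `ℰ(u, v) = 0` if `u` is constant in a neighbourhood of the support of `v`. -/
def IsStronglyLocal {M : Type*} [TopologicalSpace M] [MeasurableSpace M]
    {μ : Measure M} [IsFiniteMeasure μ] (E : DirichletForm μ) : Prop :=
  ∀ u v : E.domain,
    (∃ U : Set M, IsOpen U ∧ essSupport μ ((v : Lp ℝ 2 μ) : M → ℝ) ⊆ U ∧
      ∃ c : ℝ, ∀ᵐ y ∂μ, y ∈ U → ((u : Lp ℝ 2 μ) : M → ℝ) y = c) →
    E.form u v = 0

variable {M : Type*} [MeasurableSpace M] {μ : Measure M} [IsFiniteMeasure μ]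

/-- The Sobolev inequality `‖v‖²_{L^{2ν/(ν-2)}} ≤ A ℰ(v) + B ‖v‖²_{L²}` on `𝒟(ℰ)`; in particular
`𝒟(ℰ) ⊆ L^{2ν/(ν-2)}`. -/
def SobolevInequality (E : DirichletForm μ) (ν A B : ℝ) : Prop :=
  ∀ v : E.domain,
    eLpNorm ((v : Lp ℝ 2 μ) : M → ℝ) (ENNReal.ofReal (2 * ν / (ν - 2))) μ ^ 2
      ≤ ENNReal.ofReal (A * E.form v v + B * ‖v‖ ^ 2)

/-- A nonnegative function `W` is infinitesimally form bounded with respect to `ℰ`: for every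
`ε > 0` there is `c` with `∫ W v² dμ ≤ ε ℰ(v) + c ∫ v² dμ` for all `v ∈ 𝒟(ℰ)`. -/
def InfinitesimallyFormBounded (E : DirichletForm μ) (W : M → ℝ) : Prop :=
  ∀ ε : ℝ, 0 < ε → ∃ c : ℝ, 0 ≤ c ∧ ∀ v : E.domain,
    ∫⁻ x, ENNReal.ofReal (W x * ((v : Lp ℝ 2 μ) : M → ℝ) x ^ 2) ∂μ
      ≤ ENNReal.ofReal (ε * E.form v v + c * ‖v‖ ^ 2)

/-- The domain `𝒟(ℰ_V)`: those `v ∈ 𝒟(ℰ)` with `∫ V v² dμ` finite. -/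
def schrodingerDomain (E : DirichletForm μ) (V : M → ℝ) : Set E.domain :=
  {v | Integrable (fun x => V x * ((v : Lp ℝ 2 μ) : M → ℝ) x ^ 2) μ}

/-- The form `ℰ_V(u, v) = ℰ(u, v) + ∫ V u v dμ`, to be used on `𝒟(ℰ_V)`. -/
noncomputable def schrodingerForm (E : DirichletForm μ) (V : M → ℝ) (u v : E.domain) : ℝ :=
  E.form u v + ∫ x, V x * ((u : Lp ℝ 2 μ) : M → ℝ) x * ((v : Lp ℝ 2 μ) : M → ℝ) x ∂μ

/-- The Yamabe invariant `Y(V)`: the infimum of `ℰ_V(v)` over all `v` with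
`‖v‖_{L^{2ν/(ν-2)}} = 1`. Elements of `𝒟(ℰ)` outside `𝒟(ℰ_V)` have `ℰ_V(v) = +∞` and
do not matter for the infimum. -/
noncomputable def yamabeInvariant (E : DirichletForm μ) (V : M → ℝ) (ν : ℝ) : ℝ :=
  sInf {r : ℝ | ∃ v ∈ E.schrodingerDomain V,
    eLpNorm ((v : Lp ℝ 2 μ) : M → ℝ) (ENNReal.ofReal (2 * ν / (ν - 2))) μ = 1 ∧
      r = E.schrodingerForm V v v}

/-- `u ∈ 𝒟(ℰ_V)` is a nonnegative (weak) solution of `L u + V u = Y(V) u^{(ν+2)/(ν-2)}`, where `L`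
is the generator of `ℰ`. -/
structure IsNonnegYamabeSolution (E : DirichletForm μ) (V : M → ℝ) (ν : ℝ) (u : E.domain) :
    Prop where
  mem_domain : u ∈ E.schrodingerDomain V
  nonneg : 0 ≤ (u : Lp ℝ 2 μ)
  weak_eq : ∀ φ ∈ E.schrodingerDomain V,
    E.schrodingerForm V u φ = E.yamabeInvariant V ν *
      ∫ x, ((u : Lp ℝ 2 μ) : M → ℝ) x ^ ((ν + 2) / (ν - 2)) * ((φ : Lp ℝ 2 μ) : M → ℝ) x ∂μ

end DirichletForm

end DirichletYamabe

/-!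
Put `P = V₋ + |Y| u ^ (4 / (ν - 2))`. Then `u` is a nonnegative subsolution of `L u ≤ P u`, and `P`
is infinitesimally form bounded: by Hölder's inequality and the Sobolev inequality every potential
in `L ^ (ν / 2)` is, and `u ∈ L ^ (2ν / (ν - 2))` gives `u ^ (4 / (ν - 2)) ∈ L ^ (ν / 2)`.

Test with `w = (u - 2c)₊`. As truncation from above decreases energy, `ℰ(u ∧ 2c, w) ≥ 0`, hence
`ℰ(w) ≤ ℰ(u, w) ≤ ∫ P u w`, and `u w ≤ 2 (u - c)₊²` turns this into a bound of the energy at level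
`2c` by `ε` times the energy and a multiple of the `L²` norm at level `c`. For `c = 2 ^ n` and `ε`
small this recursion lets the energies of the dyadic excesses decay as fast as their squared `L²`
norms do. The Sobolev inequality and Chebyshev's inequality convert a decay of the `L²` norms
matching `u ∈ L ^ r` into one matching `u ∈ L ^ (r ν / (ν - 2))`, and this is iterated.
-/

open scoped ENNReal

namespace DirichletYamabe

section Real

theorem rpow_le_one_add_rpow {x s t : ℝ} (hx : 0 ≤ x) (hs : 0 ≤ s) (hst : s ≤ t) :
    x ^ s ≤ 1 + x ^ t := by
  rcases le_total x 1 with h | h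
  · exact (Real.rpow_le_one hx h hs).trans (le_add_of_nonneg_right (Real.rpow_nonneg hx t))
  · exact (Real.rpow_le_rpow_of_exponent_le h hst).trans (le_add_of_nonneg_left zero_le_one)

theorem exists_le_mul_pow_of_le_half_mul_add {a : ℕ → ℝ} {C ρ : ℝ} (hρ : 0 < ρ)
    (ha : ∀ n, a (n + 1) ≤ ρ / 2 * a n + C * ρ ^ n) : ∃ C' : ℝ, ∀ n, a n ≤ C' * ρ ^ n := by
  refine ⟨max (a 0) (2 * C / ρ), fun n => ?_⟩
  induction n with
  | zero => simp
  | succ n ih =>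
    have hC : C ≤ ρ / 2 * max (a 0) (2 * C / ρ) :=
      calc C = ρ / 2 * (2 * C / ρ) := by field_simp
        _ ≤ _ := by gcongr; exact le_max_right _ _
    calc a (n + 1) ≤ ρ / 2 * a n + C * ρ ^ n := ha n
      _ ≤ ρ / 2 * (max (a 0) (2 * C / ρ) * ρ ^ n)
          + ρ / 2 * max (a 0) (2 * C / ρ) * ρ ^ n := by gcongr
      _ = max (a 0) (2 * C / ρ) * ρ ^ (n + 1) := by ring

end Real

section Lebesgue

variable {M : Type*} [MeasurableSpace M] {μ : Measure M}

theorem ofReal_integral_le_lintegral_ofReal (f : M → ℝ) :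
    ENNReal.ofReal (∫ x, f x ∂μ) ≤ ∫⁻ x, ENNReal.ofReal (f x) ∂μ := by
  by_cases hf : Integrable f μ
  · rw [integral_eq_lintegral_pos_part_sub_lintegral_neg_part hf]
    exact (ENNReal.ofReal_le_ofReal (sub_le_self _ ENNReal.toReal_nonneg)).trans
      ENNReal.ofReal_toReal_le
  · simp [integral_undef hf]

theorem lintegral_ofReal_rpow_eq_eLpNorm_rpow {f : M → ℝ} (hf : 0 ≤ᵐ[μ] f) {s : ℝ} (hs : 0 < s) :
    ∫⁻ x, ENNReal.ofReal (f x ^ s) ∂μ = eLpNorm f (ENNReal.ofReal s) μ ^ s := by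
  rw [eLpNorm_eq_lintegral_rpow_enorm_toReal (by simpa using hs) ENNReal.ofReal_ne_top,
    ENNReal.toReal_ofReal hs.le, ← ENNReal.rpow_mul, one_div_mul_cancel hs.ne', ENNReal.rpow_one]
  refine lintegral_congr_ae ?_
  filter_upwards [hf] with x hx
  rw [Real.enorm_of_nonneg hx, ENNReal.ofReal_rpow_of_nonneg hx hs.le]

theorem lintegral_ofReal_rpow_lt_top {f : M → ℝ} (hf0 : 0 ≤ᵐ[μ] f) {s : ℝ} (hs : 0 < s)
    (hf : MemLp f (ENNReal.ofReal s) μ) : ∫⁻ x, ENNReal.ofReal (f x ^ s) ∂μ < ∞ := by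
  rw [lintegral_ofReal_rpow_eq_eLpNorm_rpow hf0 hs]
  exact ENNReal.rpow_lt_top_of_nonneg hs.le hf.eLpNorm_ne_top

theorem memLp_rpow_of_nonneg {f : M → ℝ} (hf0 : 0 ≤ᵐ[μ] f) {s γ : ℝ} (hγ : 0 < γ)
    (hf : MemLp f (ENNReal.ofReal s) μ) :
    MemLp (fun x => f x ^ γ) (ENNReal.ofReal (s / γ)) μ := by
  rw [ENNReal.ofReal_div_of_pos hγ]
  refine (hf.norm_rpow_div (ENNReal.ofReal γ)).ae_eq ?_
  filter_upwards [hf0] with x hx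
  rw [Real.norm_of_nonneg hx, ENNReal.toReal_ofReal hγ.le]

theorem lintegral_ofReal_mul_sq_le {s t : ℝ≥0∞} [s.HolderConjugate t] {W v : M → ℝ}
    (hW : AEStronglyMeasurable W μ) (hv : AEStronglyMeasurable v μ) :
    ∫⁻ x, ENNReal.ofReal (W x * v x ^ 2) ∂μ ≤ eLpNorm W s μ * eLpNorm v (t * 2) μ ^ 2 := by
  have hsq : eLpNorm (fun x => v x ^ 2) t μ = eLpNorm v (t * 2) μ ^ 2 := by
    simpa using eLpNorm_norm_rpow (p := t) (μ := μ) v two_pos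
  calc ∫⁻ x, ENNReal.ofReal (W x * v x ^ 2) ∂μ
      ≤ ∫⁻ x, ‖W x * v x ^ 2‖ₑ ∂μ := lintegral_mono fun x => Real.ofReal_le_enorm _
    _ = eLpNorm (fun x => W x * v x ^ 2) 1 μ := eLpNorm_one_eq_lintegral_enorm.symm
    _ ≤ eLpNorm W s μ * eLpNorm (fun x => v x ^ 2) t μ :=
      eLpNorm_smul_le_mul_eLpNorm (f := fun x => v x ^ 2) (φ := W) (hv.pow 2) hW
    _ = eLpNorm W s μ * eLpNorm v (t * 2) μ ^ 2 := by rw [hsq]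

theorem lintegral_ofReal_sq_eq (v : Lp ℝ 2 μ) :
    ∫⁻ x, ENNReal.ofReal (v x ^ 2) ∂μ = ENNReal.ofReal (‖v‖ ^ 2) := by
  rw [← real_inner_self_eq_norm_sq v, L2.inner_def, ofReal_integral_eq_lintegral_ofReal
    (L2.integrable_inner v v) (Eventually.of_forall fun x => real_inner_self_nonneg)]
  simp [sq]

end Lebesgue

section Excess

variable {M : Type*}

/-- The excess `(f - c)₊` of `f` over the level `c`. -/
def excess (f : M → ℝ) (c : ℝ) (x : M) : ℝ :=
  max (f x - c) 0

theorem excess_nonneg (f : M → ℝ) (c : ℝ) : 0 ≤ excess f c := fun _ => le_max_right _ _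

theorem excess_le {f : M → ℝ} {c : ℝ} {x : M} (hf : 0 ≤ f x) (hc : 0 ≤ c) : excess f c x ≤ f x :=
  max_le (sub_le_self _ hc) hf

theorem mul_excess_two_mul_le {f : M → ℝ} {c : ℝ} {x : M} (hc : 0 ≤ c) :
    f x * excess f (2 * c) x ≤ 2 * excess f c x ^ 2 := by
  unfold excess
  rcases le_total (f x) (2 * c) with h | h
  · rw [max_eq_right (sub_nonpos.2 h), mul_zero]
    positivity
  · rw [max_eq_left (by linarith), max_eq_left (by linarith)]
    nlinarith

theorem ofReal_mul_excess_two_mul_le {f : M → ℝ} {c : ℝ} {x : M} (hf : 0 ≤ f x) (hc : 0 ≤ c)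
    (a : ℝ) : ENNReal.ofReal (a * (f x * excess f (2 * c) x))
      ≤ 2 * ENNReal.ofReal (a * excess f c x ^ 2) := by
  rcases le_total 0 a with ha | ha
  · rw [← ENNReal.ofReal_ofNat 2, ← ENNReal.ofReal_mul zero_le_two, mul_left_comm 2]
    exact ENNReal.ofReal_le_ofReal (mul_le_mul_of_nonneg_left (mul_excess_two_mul_le hc) ha)
  · rw [ENNReal.ofReal_of_nonpos (mul_nonpos_of_nonpos_of_nonneg ha
      (mul_nonneg hf (excess_nonneg _ _ x)))]
    exact zero_le

theorem excess_two_mul_rpow_le {f : M → ℝ} {c s s' : ℝ} {x : M} (hc : 0 < c) (hs' : 0 < s')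
    (hs : s' ≤ s) : excess f (2 * c) x ^ s' ≤ c ^ (s' - s) * excess f c x ^ s := by
  unfold excess
  rcases le_total (f x) (2 * c) with h | h
  · rw [max_eq_right (sub_nonpos.2 h), Real.zero_rpow hs'.ne']
    positivity
  have hle : c ≤ f x - c := by linarith
  rw [max_eq_left (by linarith), max_eq_left (by linarith)]
  calc (f x - 2 * c) ^ s' ≤ (f x - c) ^ s' :=
        Real.rpow_le_rpow (by linarith) (by linarith) hs'.le
    _ = (f x - c) ^ (s' - s) * (f x - c) ^ s := by
        rw [← Real.rpow_add (hc.trans_le hle), sub_add_cancel]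
    _ ≤ c ^ (s' - s) * (f x - c) ^ s := by
        exact mul_le_mul_of_nonneg_right (Real.rpow_le_rpow_of_nonpos hc hle (by linarith))
          (Real.rpow_nonneg (hc.le.trans hle) _)

theorem exists_rpow_le_mul_excess_rpow {f : M → ℝ} {s p : ℝ} {x : M} (hs : 0 ≤ s) (hsp : s ≤ p)
    (hx : 2 ≤ f x) : ∃ n : ℕ, f x ^ p ≤ 4 ^ p * (2 ^ (p - s)) ^ n * excess f (2 ^ n) x ^ s := by
  obtain ⟨n, hn, hn'⟩ := exists_nat_pow_near (x := f x / 2) (by linarith) one_lt_two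
  rw [pow_succ] at hn'
  have hpos : 0 < f x := by linarith
  have hle : 2 ^ n ≤ f x - 2 ^ n := by linarith
  refine ⟨n, ?_⟩
  rw [excess, max_eq_left (le_trans (by positivity) hle)]
  calc f x ^ p = f x ^ (p - s) * f x ^ s := by rw [← Real.rpow_add hpos, sub_add_cancel]
    _ ≤ (4 * 2 ^ n) ^ (p - s) * (4 * (f x - 2 ^ n)) ^ s := by
        gcongr <;> linarith
    _ = 4 ^ p * (2 ^ (p - s)) ^ n * (f x - 2 ^ n) ^ s := by
        rw [Real.mul_rpow (by norm_num) (by positivity),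
          Real.mul_rpow (by norm_num) (le_trans (by positivity) hle), Real.rpow_pow_comm two_pos.le,
          show p = p - s + s by ring, Real.rpow_add (by norm_num : (0 : ℝ) < 4)]
        ring_nf

theorem ofReal_rpow_le_add_tsum_excess_rpow {f : M → ℝ} {s p : ℝ} {x : M} (hf : 0 ≤ f x)
    (hs : 0 ≤ s) (hsp : s ≤ p) : ENNReal.ofReal (f x ^ p) ≤ ENNReal.ofReal (2 ^ p)
      + ∑' n : ℕ, ENNReal.ofReal (4 ^ p * (2 ^ (p - s)) ^ n)
        * ENNReal.ofReal (excess f (2 ^ n) x ^ s) := by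
  rcases le_total (f x) 2 with h | h
  · exact le_add_of_le_left (ENNReal.ofReal_le_ofReal (Real.rpow_le_rpow hf h (hs.trans hsp)))
  · obtain ⟨n, hn⟩ := exists_rpow_le_mul_excess_rpow hs hsp h
    refine le_add_of_le_right (le_trans ?_ (ENNReal.le_tsum n))
    rw [← ENNReal.ofReal_mul (by positivity)]
    exact ENNReal.ofReal_le_ofReal hn

variable [MeasurableSpace M] {μ : Measure M} {f : M → ℝ} {s r : ℝ}

theorem aemeasurable_excess (hf : AEMeasurable f μ) (c : ℝ) : AEMeasurable (excess f c) μ :=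
  (hf.sub_const c).max aemeasurable_const

/-- Decay of order `r` of the excesses of `f` over dyadic levels, measured in `Lˢ`: the rate is
the one forced by `f ∈ Lʳ`, so that `r` plays the role of an integrability exponent of `f`
whatever `s` is. -/
def HasExcessDecay (μ : Measure M) (f : M → ℝ) (s r : ℝ) : Prop :=
  ∃ C : ℝ, 0 ≤ C ∧ ∀ n : ℕ,
    ∫⁻ x, ENNReal.ofReal (excess f (2 ^ n) x ^ s) ∂μ ≤ ENNReal.ofReal (C * (2 ^ (s - r)) ^ n)

namespace HasExcessDecay

theorem of_memLp (hs : 0 < s) (hf0 : 0 ≤ᵐ[μ] f) (hf : MemLp f (ENNReal.ofReal s) μ) :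
    HasExcessDecay μ f s s := by
  have hfin := (lintegral_ofReal_rpow_lt_top hf0 hs hf).ne
  refine ⟨(∫⁻ x, ENNReal.ofReal (f x ^ s) ∂μ).toReal, ENNReal.toReal_nonneg, fun n => ?_⟩
  rw [sub_self, Real.rpow_zero, one_pow, mul_one, ENNReal.ofReal_toReal hfin]
  refine lintegral_mono_ae ?_
  filter_upwards [hf0] with x hx
  exact ENNReal.ofReal_le_ofReal
    (Real.rpow_le_rpow (excess_nonneg f _ x) (excess_le hx (by positivity)) hs.le)

theorem lintegral_succ_le {s' C : ℝ} (hs' : 0 < s') (hs : s' ≤ s) {n : ℕ}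
    (hn : ∫⁻ x, ENNReal.ofReal (excess f (2 ^ n) x ^ s) ∂μ
      ≤ ENNReal.ofReal (C * (2 ^ (s - r)) ^ n)) :
    ∫⁻ x, ENNReal.ofReal (excess f (2 ^ (n + 1)) x ^ s') ∂μ
      ≤ ENNReal.ofReal (C * 2 ^ (r - s') * (2 ^ (s' - r)) ^ (n + 1)) := by
  have hpow : (0 : ℝ) ≤ (2 ^ n) ^ (s' - s) := by positivity
  calc ∫⁻ x, ENNReal.ofReal (excess f (2 ^ (n + 1)) x ^ s') ∂μ
      ≤ ∫⁻ x, ENNReal.ofReal ((2 ^ n) ^ (s' - s)) * ENNReal.ofReal (excess f (2 ^ n) x ^ s) ∂μ := by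
        refine lintegral_mono fun x => ?_
        rw [← ENNReal.ofReal_mul hpow, pow_succ']
        exact ENNReal.ofReal_le_ofReal (excess_two_mul_rpow_le (by positivity) hs' hs)
    _ ≤ ENNReal.ofReal ((2 ^ n) ^ (s' - s)) * ENNReal.ofReal (C * (2 ^ (s - r)) ^ n) := by
        rw [lintegral_const_mul' _ _ ENNReal.ofReal_ne_top]
        gcongr
    _ = ENNReal.ofReal (C * 2 ^ (r - s') * (2 ^ (s' - r)) ^ (n + 1)) := by
        rw [← ENNReal.ofReal_mul hpow, ← Real.rpow_pow_comm two_pos.le, pow_succ]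
        have hsplit : ((2 : ℝ) ^ (s' - s)) ^ n * (2 ^ (s - r)) ^ n = (2 ^ (s' - r)) ^ n := by
          rw [← mul_pow, ← Real.rpow_add two_pos, sub_add_sub_cancel]
        have hcancel : (2 : ℝ) ^ (r - s') * 2 ^ (s' - r) = 1 := by
          rw [← Real.rpow_add two_pos, sub_add_sub_cancel, sub_self, Real.rpow_zero]
        congr 1
        linear_combination C * hsplit - C * (2 ^ (s' - r)) ^ n * hcancel

variable [IsFiniteMeasure μ]

theorem of_le_exponent {s' : ℝ} (hdecay : HasExcessDecay μ f s r) (hs' : 0 < s') (hs : s' ≤ s) :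
    HasExcessDecay μ f s' r := by
  obtain ⟨C, hC, hbound⟩ := hdecay
  have hμ : 0 ≤ μ.real Set.univ := measureReal_nonneg
  refine ⟨μ.real Set.univ + C + C * 2 ^ (r - s'), by positivity, fun n => ?_⟩
  rcases n with _ | n
  · calc ∫⁻ x, ENNReal.ofReal (excess f (2 ^ 0) x ^ s') ∂μ
        ≤ ∫⁻ x, (1 + ENNReal.ofReal (excess f (2 ^ 0) x ^ s)) ∂μ := by
          refine lintegral_mono fun x => ?_
          rw [← ENNReal.ofReal_one, ← ENNReal.ofReal_add zero_le_one
            (Real.rpow_nonneg (excess_nonneg f _ x) s)]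
          exact ENNReal.ofReal_le_ofReal (rpow_le_one_add_rpow (excess_nonneg f _ x) hs'.le hs)
      _ ≤ ENNReal.ofReal (μ.real Set.univ) + ENNReal.ofReal C := by
          rw [lintegral_add_left measurable_const, lintegral_one, ofReal_measureReal]
          gcongr
          simpa using hbound 0
      _ ≤ _ := by
          rw [← ENNReal.ofReal_add hμ hC, pow_zero, mul_one]
          exact ENNReal.ofReal_le_ofReal (le_add_of_nonneg_right (by positivity))
  · refine (lintegral_succ_le hs' hs (hbound n)).trans (ENNReal.ofReal_le_ofReal ?_)
    gcongr
    linarith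

theorem memLp {p : ℝ} (hdecay : HasExcessDecay μ f s r) (hf : AEMeasurable f μ)
    (hf0 : 0 ≤ᵐ[μ] f) (hs : 0 < s) (hsp : s ≤ p) (hpr : p < r) :
    MemLp f (ENNReal.ofReal p) μ := by
  obtain ⟨C, -, hbound⟩ := hdecay
  have hp : 0 < p := hs.trans_le hsp
  set K : ℕ → ℝ := fun n => 4 ^ p * (2 ^ (p - s)) ^ n
  have hK (n : ℕ) : 0 ≤ K n := by positivity
  have hratio : (2 : ℝ) ^ (p - r) < 1 := Real.rpow_lt_one_of_one_lt_of_neg one_lt_two (by linarith)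
  have hterm (n : ℕ) : ENNReal.ofReal (K n) * ∫⁻ x, ENNReal.ofReal (excess f (2 ^ n) x ^ s) ∂μ
      ≤ ENNReal.ofReal (4 ^ p * C * (2 ^ (p - r)) ^ n) := by
    refine (mul_le_mul_right (hbound n) _).trans_eq ?_
    rw [← ENNReal.ofReal_mul (hK n), ← sub_add_sub_cancel p s r, Real.rpow_add two_pos, mul_pow]
    congr 1
    ring
  have hfin : ∫⁻ x, ENNReal.ofReal (f x ^ p) ∂μ < ∞ := by
    calc ∫⁻ x, ENNReal.ofReal (f x ^ p) ∂μ
        ≤ ∫⁻ x, (ENNReal.ofReal (2 ^ p)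
          + ∑' n, ENNReal.ofReal (K n) * ENNReal.ofReal (excess f (2 ^ n) x ^ s)) ∂μ :=
          lintegral_mono_ae <| hf0.mono fun x hx =>
            ofReal_rpow_le_add_tsum_excess_rpow hx hs.le hsp
      _ = ENNReal.ofReal (2 ^ p) * μ Set.univ
          + ∑' n, ENNReal.ofReal (K n) * ∫⁻ x, ENNReal.ofReal (excess f (2 ^ n) x ^ s) ∂μ := by
          rw [lintegral_add_left measurable_const, lintegral_const, lintegral_tsum fun n =>
            (((aemeasurable_excess hf _).pow_const s).ennreal_ofReal).const_mul _]
          simp only [lintegral_const_mul' _ _ ENNReal.ofReal_ne_top]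
      _ ≤ ENNReal.ofReal (2 ^ p) * μ Set.univ
          + ∑' n, ENNReal.ofReal (4 ^ p * C * (2 ^ (p - r)) ^ n) := by
          gcongr with n
          exact hterm n
      _ < ∞ := ENNReal.add_lt_top.2 ⟨ENNReal.mul_lt_top ENNReal.ofReal_lt_top (measure_lt_top _ _),
          ((summable_geometric_of_lt_one (by positivity) hratio).mul_left _).tsum_ofReal_lt_top⟩
  refine ⟨hf.aestronglyMeasurable, ?_⟩
  rw [lintegral_ofReal_rpow_eq_eLpNorm_rpow hf0 hp] at hfin
  exact (ENNReal.rpow_lt_top_iff_of_pos hp).1 hfin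

end HasExcessDecay

end Excess

theorem bilinForm_nonneg_of_forall_le {D : Type*} [AddCommGroup D] [Module ℝ D]
    {F : LinearMap.BilinForm ℝ D} (hF : ∀ v w, F v w = F w v) {v w : D}
    (h : ∀ r : ℝ, 0 < r → F v v ≤ F (v + r • w) (v + r • w)) : 0 ≤ F v w := by
  have hderiv : ∀ r : ℝ, 0 < r → 0 ≤ 2 * F v w + r * F w w := by
    intro r hr
    have hexp := h r hr
    simp only [map_add, map_smul, LinearMap.add_apply, LinearMap.smul_apply, smul_eq_mul,
      hF w v] at hexp
    exact nonneg_of_mul_nonneg_right (by linarith : 0 ≤ r * (2 * F v w + r * F w w)) hr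
  have hlim : Tendsto (fun r : ℝ => 2 * F v w + r * F w w) (𝓝[>] 0) (𝓝 (2 * F v w)) :=
    ((by fun_prop : Continuous fun r : ℝ => 2 * F v w + r * F w w).tendsto' 0 _
      (by simp)).mono_left nhdsWithin_le_nhds
  have := ge_of_tendsto hlim (eventually_mem_nhdsWithin.mono hderiv)
  linarith

namespace DirichletForm

variable {M : Type*} [MeasurableSpace M] {μ : Measure M} [IsFiniteMeasure μ] {E : DirichletForm μ}

noncomputable local instance : CoeFun E.domain fun _ => M → ℝ := ⟨fun v => ((v : Lp ℝ 2 μ) : M → ℝ)⟩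

theorem domain_ext {v w : E.domain} (h : ⇑v =ᵐ[μ] ⇑w) : v = w := Subtype.ext (Lp.ext h)

theorem aemeasurable_coeFn (v : E.domain) : AEMeasurable (⇑v) μ :=
  (Lp.aestronglyMeasurable (v : Lp ℝ 2 μ)).aemeasurable

theorem coeFn_add_smul (v w : E.domain) (r : ℝ) :
    ⇑(v + r • w) =ᵐ[μ] fun x => v x + r * w x := by
  filter_upwards [Lp.coeFn_add (v : Lp ℝ 2 μ) ((r • w : E.domain) : Lp ℝ 2 μ),
    Lp.coeFn_smul r (w : Lp ℝ 2 μ)] with x hadd hsmul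
  rw [Submodule.coe_add, hadd, Pi.add_apply, Submodule.coe_smul, hsmul, Pi.smul_apply, smul_eq_mul]

theorem exists_ae_eq_min {v : E.domain} (hv : 0 ≤ (v : Lp ℝ 2 μ)) {c : ℝ} (hc : 0 < c) :
    ∃ g : E.domain, ⇑g =ᵐ[μ] (fun x => min (v x) c) ∧ E.form g g ≤ E.form v v := by
  have hscaled : 0 ≤ ((c⁻¹ • v : E.domain) : Lp ℝ 2 μ) := by
    rw [← Lp.coeFn_nonneg]
    filter_upwards [(Lp.coeFn_nonneg _).2 hv, Lp.coeFn_smul c⁻¹ (v : Lp ℝ 2 μ)] with x hx hsmul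
    rw [Submodule.coe_smul, hsmul]
    exact mul_nonneg (inv_nonneg.2 hc.le) hx
  obtain ⟨hmem, hle⟩ := E.inf_one_contraction (c⁻¹ • v) hscaled
  refine ⟨c • ⟨_, hmem⟩, ?_, ?_⟩
  · filter_upwards [Lp.coeFn_smul c (((c⁻¹ • v : E.domain) : Lp ℝ 2 μ) ⊓ Lp.const 2 μ (1 : ℝ)),
      Lp.coeFn_inf ((c⁻¹ • v : E.domain) : Lp ℝ 2 μ) (Lp.const 2 μ (1 : ℝ)),
      Lp.coeFn_smul c⁻¹ (v : Lp ℝ 2 μ), Lp.coeFn_const (μ := μ) (p := 2) (1 : ℝ)]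
      with x hsmul hinf hsmul' hconst
    rw [Submodule.coe_smul, hsmul, Pi.smul_apply, hinf, Pi.inf_apply, Submodule.coe_smul, hsmul',
      hconst, Pi.smul_apply, smul_eq_mul, smul_eq_mul, Function.const_apply,
      mul_min_of_nonneg _ _ hc.le, mul_inv_cancel_left₀ hc.ne', mul_one]
  · simp only [map_smul, LinearMap.smul_apply, smul_eq_mul] at hle ⊢
    calc _ ≤ c * (c * (c⁻¹ * (c⁻¹ * E.form v v))) := by gcongr
      _ = E.form v v := by field_simp

theorem form_self_le_of_ae_eq_min {v w : E.domain} (hv : 0 ≤ (v : Lp ℝ 2 μ)) {c : ℝ} (hc : 0 < c)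
    (hw : ⇑w =ᵐ[μ] fun x => min (v x) c) : E.form w w ≤ E.form v v := by
  obtain ⟨g, hg, hle⟩ := exists_ae_eq_min hv hc
  rwa [domain_ext (hw.trans hg.symm)]

theorem exists_ae_eq_excess {u : E.domain} (hu : 0 ≤ (u : Lp ℝ 2 μ)) {c : ℝ} (hc : 0 < c) :
    ∃ w : E.domain, ⇑w =ᵐ[μ] excess u c ∧ E.form w w ≤ E.form u w := by
  have hu0 := (Lp.coeFn_nonneg _).2 hu
  obtain ⟨g, hg, -⟩ := exists_ae_eq_min hu hc
  have hw : ⇑(u - g) =ᵐ[μ] excess u c := by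
    filter_upwards [Lp.coeFn_sub (u : Lp ℝ 2 μ) (g : Lp ℝ 2 μ), hg] with x hsub hgx
    rw [Submodule.coe_sub, hsub, Pi.sub_apply, hgx, excess]
    rcases le_total (u x) c with h | h
    · rw [min_eq_left h, max_eq_right (sub_nonpos.2 h), sub_self]
    · rw [min_eq_right h, max_eq_left (sub_nonneg.2 h)]
  -- `u ∧ c` is the truncation at level `c` of every `u ∧ c + r (u - c)₊`, `r > 0`.
  have horth : 0 ≤ E.form g (u - g) := by
    refine bilinForm_nonneg_of_forall_le E.symm fun r hr => form_self_le_of_ae_eq_min ?_ hc ?_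
    · rw [← Lp.coeFn_nonneg]
      filter_upwards [coeFn_add_smul g (u - g) r, hg, hw, hu0] with x hadd hgx hwx hux
      rw [hadd, hgx, hwx]
      exact add_nonneg (le_min hux hc.le) (mul_nonneg hr.le (excess_nonneg _ _ _))
    · filter_upwards [coeFn_add_smul g (u - g) r, hg, hw] with x hadd hgx hwx
      rw [hadd, hgx, hwx, excess]
      rcases le_total (u x) c with h | h
      · rw [min_eq_left h, max_eq_right (sub_nonpos.2 h), mul_zero, add_zero, min_eq_left h]
      · rw [min_eq_right h, min_eq_right]
        exact le_add_of_nonneg_right (mul_nonneg hr.le (le_max_right _ _))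
  refine ⟨u - g, hw, ?_⟩
  have hsplit : E.form u (u - g) = E.form g (u - g) + E.form (u - g) (u - g) := by
    rw [← LinearMap.add_apply, ← map_add, add_sub_cancel]
  linarith

theorem SobolevInequality.lintegral_mul_sq_le {ν A B : ℝ} (hSob : E.SobolevInequality ν A B)
    (hν : 2 < ν) {W : M → ℝ} (hW : AEStronglyMeasurable W μ) (v : E.domain) :
    ∫⁻ x, ENNReal.ofReal (W x * v x ^ 2) ∂μ
      ≤ eLpNorm W (ENNReal.ofReal (ν / 2)) μ * ENNReal.ofReal (A * E.form v v + B * ‖v‖ ^ 2) := by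
  have : ν - 2 ≠ 0 := by linarith
  have hconj : (ν / 2).HolderConjugate (ν / (ν - 2)) :=
    Real.holderConjugate_iff.2 ⟨by linarith, by field_simp; ring⟩
  have := hconj.ennrealOfReal
  have hexp : ENNReal.ofReal (ν / (ν - 2)) * 2 = ENNReal.ofReal (2 * ν / (ν - 2)) := by
    rw [mul_div_assoc, ENNReal.ofReal_mul zero_le_two, ENNReal.ofReal_ofNat, mul_comm]
  calc ∫⁻ x, ENNReal.ofReal (W x * v x ^ 2) ∂μ
      ≤ eLpNorm W (ENNReal.ofReal (ν / 2)) μ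
          * eLpNorm (⇑v) (ENNReal.ofReal (ν / (ν - 2)) * 2) μ ^ 2 :=
        lintegral_ofReal_mul_sq_le hW (Lp.aestronglyMeasurable _)
    _ ≤ _ := by
        rw [hexp]
        gcongr
        exact hSob v

theorem SobolevInequality.infinitesimallyFormBounded_of_memLp {ν A B : ℝ}
    (hSob : E.SobolevInequality ν A B) (hν : 2 < ν) {W : M → ℝ}
    (hW : MemLp W (ENNReal.ofReal (ν / 2)) μ) : E.InfinitesimallyFormBounded W := by
  intro ε hε
  set δ := ε / (|A| + 1)
  have hδ : 0 < δ := by positivity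
  have hδA : δ * |A| ≤ ε := by
    rw [div_mul_eq_mul_div, div_le_iff₀ (by positivity)]
    linarith
  obtain ⟨g, hWg, -⟩ := hW.exists_simpleFunc_eLpNorm_sub_lt ENNReal.ofReal_ne_top
    (ENNReal.ofReal_pos.2 hδ).ne'
  obtain ⟨K, hK⟩ := g.exists_forall_norm_le
  refine ⟨|K| + δ * |B|, by positivity, fun v => ?_⟩
  have hform := E.nonneg v
  have hsmall : ∫⁻ x, ENNReal.ofReal ((W - ⇑g) x * v x ^ 2) ∂μ
      ≤ ENNReal.ofReal (ε * E.form v v + δ * |B| * ‖v‖ ^ 2) :=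
    calc _ ≤ _ := hSob.lintegral_mul_sq_le hν (hW.1.sub g.aestronglyMeasurable) v
      _ ≤ ENNReal.ofReal δ * ENNReal.ofReal (|A| * E.form v v + |B| * ‖v‖ ^ 2) := by
        gcongr <;> exact le_abs_self _
      _ ≤ _ := by
        rw [← ENNReal.ofReal_mul hδ.le, mul_add, ← mul_assoc, ← mul_assoc]
        gcongr
  have hbounded : ∫⁻ x, ENNReal.ofReal (|K| * v x ^ 2) ∂μ = ENNReal.ofReal (|K| * ‖v‖ ^ 2) := by
    simp only [ENNReal.ofReal_mul (abs_nonneg K)]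
    rw [lintegral_const_mul' _ _ ENNReal.ofReal_ne_top, lintegral_ofReal_sq_eq,
      Submodule.coe_norm]
  have hv := aemeasurable_coeFn v
  calc ∫⁻ x, ENNReal.ofReal (W x * v x ^ 2) ∂μ
      ≤ ∫⁻ x, (ENNReal.ofReal (|K| * v x ^ 2) + ENNReal.ofReal ((W - ⇑g) x * v x ^ 2)) ∂μ := by
        refine lintegral_mono fun x => (ENNReal.ofReal_le_ofReal ?_).trans ENNReal.ofReal_add_le
        have hgK : g x ≤ |K| := (Real.le_norm_self _).trans ((hK x).trans (le_abs_self K))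
        rw [← add_mul, Pi.sub_apply]
        gcongr
        linarith
    _ ≤ ENNReal.ofReal (|K| * ‖v‖ ^ 2) + ENNReal.ofReal (ε * E.form v v + δ * |B| * ‖v‖ ^ 2) := by
        rw [lintegral_add_left' ((hv.pow_const 2).const_mul _).ennreal_ofReal, hbounded]
        gcongr
    _ = ENNReal.ofReal (ε * E.form v v + (|K| + δ * |B|) * ‖v‖ ^ 2) := by
        rw [← ENNReal.ofReal_add (by positivity) (by positivity)]
        ring_nf

theorem InfinitesimallyFormBounded.add {W W' : M → ℝ} (hW : E.InfinitesimallyFormBounded W)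
    (hW' : E.InfinitesimallyFormBounded W') (hmeas : AEMeasurable W' μ) :
    E.InfinitesimallyFormBounded (fun x => W x + W' x) := by
  intro ε hε
  obtain ⟨c, hc, hbound⟩ := hW (ε / 2) (half_pos hε)
  obtain ⟨c', hc', hbound'⟩ := hW' (ε / 2) (half_pos hε)
  refine ⟨c + c', add_nonneg hc hc', fun v => ?_⟩
  have hv := aemeasurable_coeFn v
  have hform := E.nonneg v
  calc ∫⁻ x, ENNReal.ofReal ((W x + W' x) * v x ^ 2) ∂μ
      ≤ ∫⁻ x, (ENNReal.ofReal (W x * v x ^ 2) + ENNReal.ofReal (W' x * v x ^ 2)) ∂μ :=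
        lintegral_mono fun x => by rw [add_mul]; exact ENNReal.ofReal_add_le
    _ = ∫⁻ x, ENNReal.ofReal (W x * v x ^ 2) ∂μ + ∫⁻ x, ENNReal.ofReal (W' x * v x ^ 2) ∂μ :=
        lintegral_add_right' _ (hmeas.mul (hv.pow_const 2)).ennreal_ofReal
    _ ≤ ENNReal.ofReal (ε / 2 * E.form v v + c * ‖v‖ ^ 2)
          + ENNReal.ofReal (ε / 2 * E.form v v + c' * ‖v‖ ^ 2) := add_le_add (hbound v) (hbound' v)
    _ = ENNReal.ofReal (ε * E.form v v + (c + c') * ‖v‖ ^ 2) := by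
        rw [← ENNReal.ofReal_add (by positivity) (by positivity)]
        ring_nf

theorem exists_norm_sq_le_of_hasExcessDecay {f : M → ℝ} {r : ℝ} (hdecay : HasExcessDecay μ f 2 r) :
    ∃ D : ℝ, 0 ≤ D ∧ ∀ (n : ℕ) (w : E.domain), ⇑w =ᵐ[μ] excess f (2 ^ n) →
      ‖w‖ ^ 2 ≤ D * (2 ^ (2 - r)) ^ n := by
  obtain ⟨D, hD, hbound⟩ := hdecay
  refine ⟨D, hD, fun n w hw => ?_⟩
  rw [← ENNReal.ofReal_le_ofReal_iff (by positivity), Submodule.coe_norm,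
    ← lintegral_ofReal_sq_eq]
  refine (lintegral_congr_ae ?_).trans_le (hbound n)
  filter_upwards [hw] with x hx
  rw [hx, Real.rpow_two]

/-- `u` is a nonnegative weak subsolution of `L u ≤ P u`, tested against `0 ≤ φ ≤ u` only. The
right-hand side is `∫ (P u φ)₊`, so that no integrability of `P u φ` is presupposed. -/
structure IsNonnegSubsolution (E : DirichletForm μ) (P : M → ℝ) (u : E.domain) : Prop where
  nonneg : 0 ≤ (u : Lp ℝ 2 μ)
  form_le : ∀ φ : E.domain, 0 ≤ (φ : Lp ℝ 2 μ) → (φ : Lp ℝ 2 μ) ≤ u →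
    ENNReal.ofReal (E.form u φ) ≤ ∫⁻ x, ENNReal.ofReal (P x * (u x * φ x)) ∂μ

namespace IsNonnegSubsolution

variable {P : M → ℝ} {u : E.domain}

theorem ofReal_form_le_lintegral_excess (hu : E.IsNonnegSubsolution P u) {c : ℝ} (hc : 0 < c)
    {w : E.domain} (hw : ⇑w =ᵐ[μ] excess u (2 * c)) :
    ENNReal.ofReal (E.form w w) ≤ 2 * ∫⁻ x, ENNReal.ofReal (P x * excess u c x ^ 2) ∂μ := by
  have hu0 := (Lp.coeFn_nonneg _).2 hu.nonneg
  obtain ⟨w', hw', hle⟩ := exists_ae_eq_excess hu.nonneg (by positivity : 0 < 2 * c)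
  obtain rfl := domain_ext (hw'.trans hw.symm)
  have hw0 : 0 ≤ (w' : Lp ℝ 2 μ) := by
    rw [← Lp.coeFn_nonneg]
    filter_upwards [hw] with x hx
    exact (excess_nonneg _ _ x).trans_eq hx.symm
  have hwu : (w' : Lp ℝ 2 μ) ≤ u := by
    rw [← Lp.coeFn_le]
    filter_upwards [hw, hu0] with x hx hux
    exact hx.trans_le (excess_le hux (by positivity))
  calc ENNReal.ofReal (E.form w' w') ≤ ENNReal.ofReal (E.form u w') := ENNReal.ofReal_le_ofReal hle
    _ ≤ ∫⁻ x, ENNReal.ofReal (P x * (u x * w' x)) ∂μ := hu.form_le w' hw0 hwu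
    _ ≤ ∫⁻ x, 2 * ENNReal.ofReal (P x * excess u c x ^ 2) ∂μ := by
        refine lintegral_mono_ae ?_
        filter_upwards [hw, hu0] with x hx hux
        rw [hx]
        exact ofReal_mul_excess_two_mul_le hux hc.le _
    _ = 2 * ∫⁻ x, ENNReal.ofReal (P x * excess u c x ^ 2) ∂μ :=
        lintegral_const_mul' _ _ ENNReal.ofNat_ne_top

theorem form_excess_le (hu : E.IsNonnegSubsolution P u) {c ε C : ℝ} (hc : 0 < c) (hε : 0 ≤ ε)
    (hC : 0 ≤ C)
    (hP : ∀ v : E.domain, ∫⁻ x, ENNReal.ofReal (P x * v x ^ 2) ∂μ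
      ≤ ENNReal.ofReal (ε * E.form v v + C * ‖v‖ ^ 2))
    {v w : E.domain} (hv : ⇑v =ᵐ[μ] excess u c) (hw : ⇑w =ᵐ[μ] excess u (2 * c)) :
    E.form w w ≤ 2 * (ε * E.form v v + C * ‖v‖ ^ 2) := by
  have hform := E.nonneg v
  rw [← ENNReal.ofReal_le_ofReal_iff (by positivity)]
  calc ENNReal.ofReal (E.form w w)
      ≤ 2 * ∫⁻ x, ENNReal.ofReal (P x * excess u c x ^ 2) ∂μ :=
        hu.ofReal_form_le_lintegral_excess hc hw
    _ = 2 * ∫⁻ x, ENNReal.ofReal (P x * v x ^ 2) ∂μ := by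
        congr 1
        refine lintegral_congr_ae ?_
        filter_upwards [hv] with x hx
        rw [hx]
    _ ≤ ENNReal.ofReal (2 * (ε * E.form v v + C * ‖v‖ ^ 2)) := by
        rw [ENNReal.ofReal_mul zero_le_two, ENNReal.ofReal_ofNat]
        gcongr
        exact hP v

theorem exists_form_excess_le (hu : E.IsNonnegSubsolution P u)
    (hP : E.InfinitesimallyFormBounded P) {r : ℝ} (hdecay : HasExcessDecay μ u 2 r) :
    ∃ K : ℝ, ∀ (n : ℕ) (w : E.domain), ⇑w =ᵐ[μ] excess u (2 ^ n) →
      E.form w w ≤ K * (2 ^ (2 - r)) ^ n := by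
  choose w hw _ using fun n : ℕ =>
    exists_ae_eq_excess hu.nonneg (pow_pos two_pos n : (0 : ℝ) < 2 ^ n)
  obtain ⟨D, -, hnorm⟩ := exists_norm_sq_le_of_hasExcessDecay hdecay
  set ρ : ℝ := 2 ^ (2 - r)
  have hρ : 0 < ρ := by positivity
  obtain ⟨c, hc, hbound⟩ := hP (ρ / 4) (by positivity)
  obtain ⟨K, hK⟩ := exists_le_mul_pow_of_le_half_mul_add (a := fun n => E.form (w n) (w n))
    (C := 2 * (c * D)) hρ fun n => by
      calc E.form (w (n + 1)) (w (n + 1))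
          ≤ 2 * (ρ / 4 * E.form (w n) (w n) + c * ‖w n‖ ^ 2) :=
            hu.form_excess_le (by positivity) (by positivity) hc hbound (hw n)
              (pow_succ' (2 : ℝ) n ▸ hw (n + 1))
        _ ≤ 2 * (ρ / 4 * E.form (w n) (w n) + c * (D * ρ ^ n)) := by
            gcongr
            exact hnorm n _ (hw n)
        _ = ρ / 2 * E.form (w n) (w n) + 2 * (c * D) * ρ ^ n := by ring
  refine ⟨K, fun n v hv => ?_⟩
  rw [domain_ext (hv.trans (hw n).symm)]
  exact hK n

theorem hasExcessDecay_mul (hu : E.IsNonnegSubsolution P u) (hP : E.InfinitesimallyFormBounded P)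
    {ν A B : ℝ} (hSob : E.SobolevInequality ν A B) (hν : 2 < ν) {r : ℝ}
    (hdecay : HasExcessDecay μ u 2 r) :
    HasExcessDecay μ u (2 * (ν / (ν - 2))) (r * (ν / (ν - 2))) := by
  obtain ⟨D, hD, hnorm⟩ := exists_norm_sq_le_of_hasExcessDecay hdecay
  obtain ⟨K, hK⟩ := hu.exists_form_excess_le hP hdecay
  have hσ : 0 < ν / (ν - 2) := div_pos (by linarith) (by linarith)
  have hexp : 2 * ν / (ν - 2) = 2 * (ν / (ν - 2)) := mul_div_assoc _ _ _
  rw [SobolevInequality, hexp] at hSob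
  set σ := ν / (ν - 2)
  refine ⟨(|A| * |K| + |B| * D) ^ σ, by positivity, fun n => ?_⟩
  obtain ⟨w, hw, -⟩ := exists_ae_eq_excess hu.nonneg (pow_pos two_pos n : (0 : ℝ) < 2 ^ n)
  have hform := E.nonneg w
  have hle : A * E.form w w + B * ‖w‖ ^ 2 ≤ (|A| * |K| + |B| * D) * (2 ^ (2 - r)) ^ n :=
    calc A * E.form w w + B * ‖w‖ ^ 2
        ≤ |A| * (|K| * (2 ^ (2 - r)) ^ n) + |B| * (D * (2 ^ (2 - r)) ^ n) := by
          gcongr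
          · exact le_abs_self A
          · exact (hK n w hw).trans (by gcongr; exact le_abs_self K)
          · exact le_abs_self B
          · exact hnorm n w hw
      _ = _ := by ring
  calc ∫⁻ x, ENNReal.ofReal (excess u (2 ^ n) x ^ (2 * σ)) ∂μ
      = eLpNorm (⇑w) (ENNReal.ofReal (2 * σ)) μ ^ (2 * σ) := by
        rw [lintegral_ofReal_rpow_eq_eLpNorm_rpow (Eventually.of_forall (excess_nonneg _ _))
          (by positivity), eLpNorm_congr_ae hw]
    _ = (eLpNorm (⇑w) (ENNReal.ofReal (2 * σ)) μ ^ 2) ^ σ := by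
        rw [ENNReal.rpow_mul, ENNReal.rpow_two]
    _ ≤ ENNReal.ofReal ((|A| * |K| + |B| * D) * (2 ^ (2 - r)) ^ n) ^ σ := by
        gcongr
        exact (hSob w).trans (ENNReal.ofReal_le_ofReal hle)
    _ = ENNReal.ofReal ((|A| * |K| + |B| * D) ^ σ * (2 ^ (2 * σ - r * σ)) ^ n) := by
        rw [ENNReal.ofReal_rpow_of_nonneg (by positivity) hσ.le,
          Real.mul_rpow (by positivity) (by positivity), ← Real.rpow_pow_comm (by positivity),
          ← Real.rpow_mul two_pos.le, sub_mul]

theorem hasExcessDecay_two_mul_pow (hu : E.IsNonnegSubsolution P u)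
    (hP : E.InfinitesimallyFormBounded P) {ν A B : ℝ} (hSob : E.SobolevInequality ν A B)
    (hν : 2 < ν) (k : ℕ) : HasExcessDecay μ u 2 (2 * (ν / (ν - 2)) ^ k) := by
  have hσ : 1 ≤ ν / (ν - 2) := (one_le_div (by linarith)).2 (by linarith)
  induction k with
  | zero =>
    rw [pow_zero, mul_one]
    refine .of_memLp two_pos ((Lp.coeFn_nonneg _).2 hu.nonneg) ?_
    rw [ENNReal.ofReal_ofNat]
    exact Lp.memLp _
  | succ k ih =>
    rw [pow_succ, ← mul_assoc]
    exact (hu.hasExcessDecay_mul hP hSob hν ih).of_le_exponent two_pos (by linarith)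

theorem memLp (hu : E.IsNonnegSubsolution P u) (hP : E.InfinitesimallyFormBounded P)
    {ν A B : ℝ} (hSob : E.SobolevInequality ν A B) (hν : 2 < ν) {p : ℝ≥0∞} (hp : p ≠ ∞) :
    MemLp u p μ := by
  have hσ : 1 < ν / (ν - 2) := (one_lt_div (by linarith)).2 (by linarith)
  obtain ⟨k, hk⟩ := pow_unbounded_of_one_lt (p.toReal + 2) hσ
  have hlarge : MemLp u (ENNReal.ofReal (p.toReal + 2)) μ :=
    (hu.hasExcessDecay_two_mul_pow hP hSob hν k).memLp (aemeasurable_coeFn u)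
      ((Lp.coeFn_nonneg _).2 hu.nonneg) two_pos (le_add_of_nonneg_left ENNReal.toReal_nonneg)
      (by nlinarith [ENNReal.toReal_nonneg (a := p)])
  exact hlarge.mono_exponent ((ENNReal.le_ofReal_iff_toReal_le hp (by positivity)).2 (by linarith))

end IsNonnegSubsolution

theorem SobolevInequality.memLp {ν A B : ℝ} (hSob : E.SobolevInequality ν A B) (v : E.domain) :
    MemLp v (ENNReal.ofReal (2 * ν / (ν - 2))) μ :=
  ⟨Lp.aestronglyMeasurable _, (ENNReal.pow_lt_top_iff.1
    ((hSob v).trans_lt ENNReal.ofReal_lt_top)).resolve_right two_ne_zero⟩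

theorem SobolevInequality.infinitesimallyFormBounded_const_mul_rpow {ν A B : ℝ}
    (hSob : E.SobolevInequality ν A B) (hν : 2 < ν) {u : E.domain} (hu : 0 ≤ (u : Lp ℝ 2 μ))
    (a : ℝ) : E.InfinitesimallyFormBounded fun x => a * u x ^ (4 / (ν - 2)) := by
  have hγ : 0 < 4 / (ν - 2) := div_pos four_pos (by linarith)
  have hexp : 2 * ν / (ν - 2) / (4 / (ν - 2)) = ν / 2 := by
    have : ν - 2 ≠ 0 := by linarith
    field_simp
    norm_num
  refine hSob.infinitesimallyFormBounded_of_memLp hν (MemLp.const_mul ?_ a)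
  rw [← hexp]
  exact memLp_rpow_of_nonneg ((Lp.coeFn_nonneg _).2 hu) hγ (hSob.memLp u)

theorem mem_schrodingerDomain_of_le {V : M → ℝ} {u φ : E.domain} (hu : u ∈ E.schrodingerDomain V)
    (hφ : 0 ≤ (φ : Lp ℝ 2 μ)) (hφu : (φ : Lp ℝ 2 μ) ≤ u) : φ ∈ E.schrodingerDomain V := by
  have hmeas : AEStronglyMeasurable (fun x => (φ x / u x) ^ 2) μ :=
    (((aemeasurable_coeFn φ).div (aemeasurable_coeFn u)).pow_const 2).aestronglyMeasurable
  have hle := ((Lp.coeFn_nonneg _).2 hφ).and ((Lp.coeFn_le _ _).2 hφu)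
  -- `V φ² = (φ / u)² (V u²)`, where `V u²` is integrable and `0 ≤ φ / u ≤ 1`.
  refine (Integrable.bdd_mul (c := 1) hu hmeas ?_).congr ?_
  · filter_upwards [hle] with x ⟨h0, h1⟩
    rw [Real.norm_of_nonneg (sq_nonneg _)]
    exact pow_le_one₀ (div_nonneg h0 (h0.trans h1)) (div_le_one_of_le₀ h1 (h0.trans h1))
  · filter_upwards [hle] with x ⟨h0, h1⟩
    rcases eq_or_ne (u x) 0 with hux | hux
    · rw [hux] at h1 ⊢
      simp [le_antisymm h1 h0]
    · field_simp

theorem isNonnegSubsolution_of_schrodingerForm_le {V : M → ℝ} {u : E.domain}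
    (hu : 0 ≤ (u : Lp ℝ 2 μ)) (huV : u ∈ E.schrodingerDomain V) {Y γ : ℝ} (hγ : γ + 1 ≠ 0)
    (hsub : ∀ φ ∈ E.schrodingerDomain V, 0 ≤ (φ : Lp ℝ 2 μ) →
      E.schrodingerForm V u φ ≤ Y * ∫ x, u x ^ (γ + 1) * φ x ∂μ) :
    E.IsNonnegSubsolution (fun x => max 0 (-V x) + |Y| * u x ^ γ) u where
  nonneg := hu
  form_le φ hφ hφu := by
    have hweak : E.form u φ
        ≤ ∫ x, -(V x * u x * φ x) ∂μ + ∫ x, Y * (u x ^ (γ + 1) * φ x) ∂μ := by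
      have := hsub φ (mem_schrodingerDomain_of_le huV hφ hφu) hφ
      rw [schrodingerForm] at this
      rw [integral_neg, integral_const_mul]
      linarith
    calc ENNReal.ofReal (E.form u φ)
        ≤ ENNReal.ofReal (∫ x, -(V x * u x * φ x) ∂μ)
          + ENNReal.ofReal (∫ x, Y * (u x ^ (γ + 1) * φ x) ∂μ) :=
          (ENNReal.ofReal_le_ofReal hweak).trans ENNReal.ofReal_add_le
      _ ≤ ∫⁻ x, ENNReal.ofReal (-(V x * u x * φ x)) ∂μ
          + ∫⁻ x, ENNReal.ofReal (Y * (u x ^ (γ + 1) * φ x)) ∂μ :=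
          add_le_add (ofReal_integral_le_lintegral_ofReal _) (ofReal_integral_le_lintegral_ofReal _)
      _ = ∫⁻ x, (ENNReal.ofReal (-(V x * u x * φ x))
          + ENNReal.ofReal (Y * (u x ^ (γ + 1) * φ x))) ∂μ :=
          (lintegral_add_right' _
            ((((aemeasurable_coeFn u).pow_const _).mul
              (aemeasurable_coeFn φ)).const_mul Y).ennreal_ofReal).symm
      _ ≤ ∫⁻ x, ENNReal.ofReal ((max 0 (-V x) + |Y| * u x ^ γ) * (u x * φ x)) ∂μ := by
          refine lintegral_mono_ae ?_
          filter_upwards [(Lp.coeFn_nonneg _).2 hu, (Lp.coeFn_nonneg _).2 hφ] with x hux hφx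
          have huφ : 0 ≤ u x * φ x := mul_nonneg hux hφx
          have hpow : 0 ≤ u x ^ γ := Real.rpow_nonneg hux γ
          have hpotential : -(V x * u x * φ x) ≤ max 0 (-V x) * (u x * φ x) := by
            rw [mul_assoc, ← neg_mul]
            exact mul_le_mul_of_nonneg_right (le_max_right _ _) huφ
          have hnonlinear : Y * (u x ^ (γ + 1) * φ x) ≤ |Y| * u x ^ γ * (u x * φ x) := by
            rw [Real.rpow_add_one' hux hγ, mul_assoc (u x ^ γ), ← mul_assoc]
            exact mul_le_mul_of_nonneg_right (mul_le_mul_of_nonneg_right (le_abs_self Y) hpow) huφ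
          rw [add_mul, ENNReal.ofReal_add (by positivity) (by positivity)]
          gcongr

end DirichletForm

end DirichletYamabe

open DirichletYamabe in
theorem mainTheorem7_general {M : Type*} [MeasurableSpace M] {μ : Measure M} [IsFiniteMeasure μ]
    {E : DirichletForm μ} {ν A B : ℝ} (hν : 2 < ν) (hSob : E.SobolevInequality ν A B) {V : M → ℝ}
    (hVneg : E.InfinitesimallyFormBounded (fun x => max 0 (-V x))) {u : E.domain}
    (hu : 0 ≤ (u : Lp ℝ 2 μ)) (huV : u ∈ E.schrodingerDomain V) {Y : ℝ}
    (hsub : ∀ φ ∈ E.schrodingerDomain V, 0 ≤ (φ : Lp ℝ 2 μ) →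
      E.schrodingerForm V u φ ≤ Y *
        ∫ x, ((u : Lp ℝ 2 μ) : M → ℝ) x ^ ((ν + 2) / (ν - 2)) * ((φ : Lp ℝ 2 μ) : M → ℝ) x ∂μ)
    {p : ℝ≥0∞} (hp : p ≠ ∞) : MemLp ((u : Lp ℝ 2 μ) : M → ℝ) p μ := by
  have hγ : 0 < 4 / (ν - 2) := div_pos four_pos (by linarith)
  have hexp : (ν + 2) / (ν - 2) = 4 / (ν - 2) + 1 := by
    rw [div_add_one (by linarith)]
    ring_nf
  rw [hexp] at hsub
  have hP := hVneg.add (hSob.infinitesimallyFormBounded_const_mul_rpow hν hu |Y|)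
    (((DirichletForm.aemeasurable_coeFn u).pow_const _).const_mul _)
  exact (DirichletForm.isNonnegSubsolution_of_schrodingerForm_le hu huV (by positivity) hsub).memLp
    hP hSob hν hp

theorem mainTheorem7 {M : Type*} [TopologicalSpace M] [CompactSpace M] [MeasurableSpace M]
    [BorelSpace M] (μ : Measure M) [IsFiniteMeasure μ] [μ.Regular]
    (E : DirichletYamabe.DirichletForm μ) (hreg : E.IsRegular) (hloc : E.IsStronglyLocal)
    (ν A B : ℝ) (hν : 2 < ν) (hA : 0 < A) (hB : 0 < B) (hSob : E.SobolevInequality ν A B)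
    (V : M → ℝ) (hV : Integrable V μ)
    (hVneg : E.InfinitesimallyFormBounded (fun x => max 0 (-V x)))
    (u : E.domain) (hu : E.IsNonnegYamabeSolution V ν u) (p : ℝ) (hp : 2 ≤ p) :
    ∫⁻ x, ENNReal.ofReal (((u : Lp ℝ 2 μ) : M → ℝ) x ^ p) ∂μ < ⊤ := by
  exact DirichletYamabe.lintegral_ofReal_rpow_lt_top ((Lp.coeFn_nonneg _).2 hu.nonneg)
    (zero_lt_two.trans_le hp) (mainTheorem7_general hν hSob hVneg hu.nonneg hu.mem_domain
      (fun φ hφ _ => (hu.weak_eq φ hφ).le) ENNReal.ofReal_ne_top)
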